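/- Let $(M,g)$ be a smooth Riemannian manifold (without boundary) with Levi-Civita connection $\nabla$, and let $f\in C^\infty(M)$. Write $\operatorname{grad}f$ for the gradient of $f$, $\operatorname{Hess}_f(X,Y)=g(\nabla_X\operatorname{grad}f,Y)$ for its Hessian, $\Delta f=\operatorname{trace}_g\operatorname{Hess}_f$ for its Laplacian, $\|X\|^2=g(X,X)$, and $\operatorname{Ric}(Y,Z)=\operatorname{trace}\big(X\mapsto R(X,Y)Z\big)$ with $R(X,Y)Z=\nabla_X\nabla_YZ-\nabla_Y\nabla_XZ-\nabla_{[X,Y]}Z$ for the Ricci curvature. Define the symmetric $(0,2)$-tensor field $$\chi=\|\operatorname{grad}f\|^{2}\operatorname{Hess}_{f}+(\Delta f)\,(g-df\otimes df),$$ and let $(\operatorname{div}\chi)(V)=\sum_i(\nabla_{e_i}\chi)(e_i,V)$, where $(e_i)$ is a local orthonormal frame. Then, for every smooth vector field $V$ on $M$, $$\begin{aligned}(\operatorname{div}\chi)(V)={}&g\big(\nabla_{V}\operatorname{grad}f,\operatorname{grad}\|\operatorname{grad}f\|^{2}\big)+\|\operatorname{grad}f\|^{2}\operatorname{Ric}(\operatorname{grad}f,V)\\&+\big(1+\|\operatorname{grad}f\|^{2}\big)\,g(\operatorname{grad}\Delta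 f,V)-g(\operatorname{grad}\Delta f,\operatorname{grad}f)\,g(V,\operatorname{grad}f)\\&-(\Delta f)^2g(V,\operatorname{grad}f)-\tfrac{1}{2}(\Delta f)\,g\big(V,\operatorname{grad}\|\operatorname{grad}f\|^{2}\big).\end{aligned}$$ -/

import Mathlib

open Bundle FiberBundle VectorField
open scoped Manifold ContDiff

set_option linter.unusedSectionVars false

noncomputable section

namespace RiemGeom

variable {E : Type*} [NormedAddCommGroup E] [NormedSpace ℝ E] [FiniteDimensional ℝ E]
  {H : Type*} [TopologicalSpace H] {I : ModelWithCorners ℝ E H}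
  {M : Type*} [TopologicalSpace M] [ChartedSpace H M] [IsManifold I ∞ M]
  [RiemannianBundle (fun x : M ↦ TangentSpace I x)]
  [IsContMDiffRiemannianBundle I ∞ E (fun x : M ↦ TangentSpace I x)]

theorem mdiffAt_inner {x : M} {Y Z : Π x : M, TangentSpace I x}
    (hY : MDiffAt (T% Y) x) (hZ : MDiffAt (T% Z) x) :
    MDiffAt (fun y ↦ inner ℝ (Y y) (Z y)) x :=
  MDifferentiableAt.inner_bundle (F := E) (E := fun x : M ↦ TangentSpace I x) (b := fun y ↦ y)
    (v := Y) (w := Z) hY hZ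

/-- The right-hand side of the Koszul formula
`2 g(∇_X Y, Z) = X g(Y,Z) + Y g(Z,X) - Z g(X,Y) + g([X,Y],Z) - g([X,Z],Y) - g([Y,Z],X)`. -/
def koszul (X Y Z : Π x : M, TangentSpace I x) (x : M) : ℝ :=
  d% (fun y ↦ inner ℝ (Y y) (Z y)) x (X x) + d% (fun y ↦ inner ℝ (Z y) (X y)) x (Y x)
    - d% (fun y ↦ inner ℝ (X y) (Y y)) x (Z x)
    + inner ℝ (mlieBracket I X Y x) (Z x) - inner ℝ (mlieBracket I X Z x) (Y x)
    - inner ℝ (mlieBracket I Y Z x) (X x)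

theorem koszul_tensorial_fst {x : M} {Y Z : Π x : M, TangentSpace I x}
    (hY : MDiffAt (T% Y) x) (hZ : MDiffAt (T% Z) x) :
    TensorialAt I E (fun X ↦ koszul X Y Z x) x where
  smul {f X} hf hX := by
    have := FiniteDimensional.complete ℝ E
    simp [koszul, real_inner_smul_left, real_inner_smul_right, inner_add_left,
      mvfderiv_fun_mul hf (mdiffAt_inner hZ hX), mvfderiv_fun_mul hf (mdiffAt_inner hX hY),
      mlieBracket_smul_left hf hX]
    rw [real_inner_comm (X x) (Z x)]
    ring
  add {X X'} hX hX' := by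
    have := FiniteDimensional.complete ℝ E
    simp [koszul, inner_add_left, inner_add_right,
      mvfderiv_fun_add (mdiffAt_inner hZ hX) (mdiffAt_inner hZ hX'),
      mvfderiv_fun_add (mdiffAt_inner hX hY) (mdiffAt_inner hX' hY),
      mlieBracket_add_left hX hX']
    ring

theorem koszul_tensorial_trd {x : M} {X Y : Π x : M, TangentSpace I x}
    (hX : MDiffAt (T% X) x) (hY : MDiffAt (T% Y) x) :
    TensorialAt I E (fun Z ↦ koszul X Y Z x) x where
  smul {f Z} hf hZ := by
    have := FiniteDimensional.complete ℝ E
    simp [koszul, real_inner_smul_left, real_inner_smul_right, inner_add_left,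
      mvfderiv_fun_mul hf (mdiffAt_inner hZ hX), mvfderiv_fun_mul hf (mdiffAt_inner hY hZ),
      mlieBracket_smul_right hf hZ]
    rw [real_inner_comm (Y x) (Z x)]
    ring
  add {Z Z'} hZ hZ' := by
    have := FiniteDimensional.complete ℝ E
    simp [koszul, inner_add_left, inner_add_right,
      mvfderiv_fun_add (mdiffAt_inner hZ hX) (mdiffAt_inner hZ' hX),
      mvfderiv_fun_add (mdiffAt_inner hY hZ) (mdiffAt_inner hY hZ'),
      mlieBracket_add_right hZ hZ']
    ring

/-- The bilinear form `(X, Z) ↦ koszul X Y Z x` on the tangent space at `x`; by convention it is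
zero if `Y` is not differentiable at `x`. -/
def koszulForm (Y : Π x : M, TangentSpace I x) (x : M) :
    TangentSpace I x →L[ℝ] TangentSpace I x →L[ℝ] ℝ :=
  open scoped Classical in
  if hY : MDiffAt (T% Y) x then
    TensorialAt.mkHom₂ (fun X Z ↦ koszul X Y Z x) x
      (fun _ hZ ↦ koszul_tensorial_fst hY hZ) (fun _ hX ↦ koszul_tensorial_trd hX hY)
  else 0

theorem koszulForm_apply {x : M} {X Y Z : Π x : M, TangentSpace I x}
    (hX : MDiffAt (T% X) x) (hY : MDiffAt (T% Y) x) (hZ : MDiffAt (T% Z) x) :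
    koszulForm Y x (X x) (Z x) = koszul X Y Z x := by
  rw [koszulForm, dif_pos hY]
  exact TensorialAt.mkHom₂_apply _ _ hX hZ

instance instFinDimTangent (x : M) : FiniteDimensional ℝ (TangentSpace I x) :=
  inferInstanceAs (FiniteDimensional ℝ E)

instance instCompleteTangent (x : M) : CompleteSpace (TangentSpace I x) :=
  FiniteDimensional.complete ℝ _

/-- The vector of `T_x M` that represents a linear form with respect to the metric. -/
def sharp (x : M) : (TangentSpace I x →L[ℝ] ℝ) →L[ℝ] TangentSpace I x :=
  LinearMap.toContinuousLinearMap
    { toFun := fun φ ↦ (InnerProductSpace.toDual ℝ (TangentSpace I x)).symm φ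
      map_add' := fun φ ψ ↦ map_add _ φ ψ
      map_smul' := fun c φ ↦ by simp }

theorem inner_sharp (x : M) (φ : TangentSpace I x →L[ℝ] ℝ) (v : TangentSpace I x) :
    inner ℝ (sharp x φ) v = φ v := by
  simp [sharp]

/-- The Levi-Civita connection, given by the Koszul formula. As usual for `CovariantDerivative`,
`leviCivita Y x (X x)` is the value of `∇_X Y` at `x`. -/
def leviCivita : CovariantDerivative I E (fun x : M ↦ TangentSpace I x) where
  toFun Y x := (1 / 2 : ℝ) • (sharp x ∘L koszulForm Y x)
  isCovariantDerivativeOnUniv :=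
    { add := by
        intro Y Y' x hY hY' _
        have := FiniteDimensional.complete ℝ E
        ext v
        refine ext_inner_right ℝ fun w ↦ ?_
        have hv := mdifferentiableAt_extend I E v
        have hw := mdifferentiableAt_extend I E w
        have h1 := koszulForm_apply hv (mdifferentiableAt_add_section hY hY') hw
        have h2 := koszulForm_apply hv hY hw
        have h3 := koszulForm_apply hv hY' hw
        simp only [extend_apply_self] at h1 h2 h3
        simp [inner_add_left, real_inner_smul_left, inner_sharp]
        erw [h1, h2, h3]
        simp [koszul, inner_add_left, inner_add_right,
          mvfderiv_fun_add (mdiffAt_inner hY hw) (mdiffAt_inner hY' hw),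
          mvfderiv_fun_add (mdiffAt_inner hv hY) (mdiffAt_inner hv hY'),
          mlieBracket_add_right hY hY', mlieBracket_add_left hY hY']
        ring
      leibniz := by
        intro Y f x hY hf _
        have := FiniteDimensional.complete ℝ E
        ext v
        refine ext_inner_right ℝ fun w ↦ ?_
        have hv := mdifferentiableAt_extend I E v
        have hw := mdifferentiableAt_extend I E w
        have h1 := koszulForm_apply hv (hf.smul_section hY) hw
        have h2 := koszulForm_apply hv hY hw
        simp only [extend_apply_self] at h1 h2
        simp [inner_add_left, real_inner_smul_left, inner_sharp]
        erw [h1, h2]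
        simp [koszul, real_inner_smul_left, real_inner_smul_right, inner_add_left,
          mvfderiv_fun_mul hf (mdiffAt_inner hv hY), mvfderiv_fun_mul hf (mdiffAt_inner hY hw),
          mlieBracket_smul_right hf hY, mlieBracket_smul_left hf hY]
        rw [real_inner_comm v (Y x)]
        ring }

theorem two_mul_inner_leviCivita {x : M} {X Y Z : Π x : M, TangentSpace I x}
    (hX : MDiffAt (T% X) x) (hY : MDiffAt (T% Y) x) (hZ : MDiffAt (T% Z) x) :
    2 * inner ℝ (leviCivita Y x (X x)) (Z x) = koszul X Y Z x := by
  rw [← koszulForm_apply hX hY hZ]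
  simp [leviCivita, real_inner_smul_left, inner_sharp]

/-- The connection `leviCivita` is torsion-free. -/
theorem leviCivita_torsion : (leviCivita (I := I) (M := M)).torsion = 0 := by
  have := FiniteDimensional.complete ℝ E
  rw [CovariantDerivative.torsion_eq_zero_iff]
  intro X Y x hX hY
  refine ext_inner_right ℝ fun w ↦ ?_
  have hw := mdifferentiableAt_extend I E w
  have h1 := two_mul_inner_leviCivita hX hY hw
  have h2 := two_mul_inner_leviCivita hY hX hw
  have h3 : mlieBracket I Y X x = - mlieBracket I X Y x := mlieBracket_swap_apply
  simp only [koszul, extend_apply_self, h3, inner_neg_left,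
    fun y ↦ real_inner_comm (X y) (Y y), fun y ↦ real_inner_comm (X y) (extend E w y),
    fun y ↦ real_inner_comm (Y y) (extend E w y)] at h1 h2
  rw [inner_sub_left]
  linarith

/-- The connection `leviCivita` is compatible with the metric. -/
theorem leviCivita_metric {x : M} {X Y Z : Π x : M, TangentSpace I x}
    (hX : MDiffAt (T% X) x) (hY : MDiffAt (T% Y) x) (hZ : MDiffAt (T% Z) x) :
    d% (fun y ↦ inner ℝ (Y y) (Z y)) x (X x) =
      inner ℝ (leviCivita Y x (X x)) (Z x) + inner ℝ (Y x) (leviCivita Z x (X x)) := by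
  have h1 := two_mul_inner_leviCivita hX hY hZ
  have h2 := two_mul_inner_leviCivita hX hZ hY
  have h3 : mlieBracket I Z Y x = - mlieBracket I Y Z x := mlieBracket_swap_apply
  simp only [koszul, h3, inner_neg_left, fun y ↦ real_inner_comm (Y y) (Z y),
    fun y ↦ real_inner_comm (Z y) (X y), fun y ↦ real_inner_comm (Y y) (X y)] at h1 h2
  rw [real_inner_comm (leviCivita Z x (X x)) (Y x)]
  linarith

/-- The metric tensor `g` at `x`. -/
def metric (x : M) : TangentSpace I x →L[ℝ] TangentSpace I x →L[ℝ] ℝ :=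
  innerSL ℝ

theorem metric_apply (x : M) (v w : TangentSpace I x) : metric x v w = inner ℝ v w :=
  rfl

/-- The vector field `∇_X Y`. -/
def nabla (X Y : Π x : M, TangentSpace I x) (x : M) : TangentSpace I x :=
  leviCivita Y x (X x)

/-- The gradient of a function: `g(grad f, v) = df(v)`. -/
def grad (f : M → ℝ) (x : M) : TangentSpace I x :=
  sharp x (d% f x)

/-- The Hessian `Hess_f(v, w) = g(∇_v grad f, w)`. -/
def hess (f : M → ℝ) (x : M) : TangentSpace I x →L[ℝ] TangentSpace I x →L[ℝ] ℝ :=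
  metric x ∘L leviCivita (grad f) x

/-- The Laplacian `Δf = trace_g Hess_f = div grad f`, the trace of the endomorphism
`v ↦ ∇_v grad f` of the tangent space. -/
def laplacian (f : M → ℝ) (x : M) : ℝ :=
  LinearMap.trace ℝ (TangentSpace I x) (leviCivita (grad f) x).toLinearMap

/-- The curvature `R(X, Y) Z = ∇_X ∇_Y Z - ∇_Y ∇_X Z - ∇_[X,Y] Z`. -/
def curvature (X Y Z : Π x : M, TangentSpace I x) (x : M) : TangentSpace I x :=
  nabla X (nabla Y Z) x - nabla Y (nabla X Z) x - nabla (mlieBracket I X Y) Z x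

/-- The Ricci curvature `Ric(Y, Z) = trace (X ↦ R(X, Y) Z) = ∑ᵢ g(R(eᵢ, Y) Z, eᵢ)`, where `(eᵢ)` is
an orthonormal basis of the tangent space at `x`, extended to smooth local vector fields
(the value at `x` does not depend on the extension). -/
def ricci (Y Z : Π x : M, TangentSpace I x) (x : M) : ℝ :=
  ∑ i, inner ℝ (curvature (extend E (stdOrthonormalBasis ℝ (TangentSpace I x) i)) Y Z x)
    (stdOrthonormalBasis ℝ (TangentSpace I x) i)

/-- The covariant derivative of a 2-tensor field:
`(∇_X T)(Y, Z) = X (T(Y, Z)) - T(∇_X Y, Z) - T(Y, ∇_X Z)`. -/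
def nablaTensor (T : Π x : M, TangentSpace I x →L[ℝ] TangentSpace I x →L[ℝ] ℝ)
    (X Y Z : Π x : M, TangentSpace I x) (x : M) : ℝ :=
  d% (fun y ↦ T y (Y y) (Z y)) x (X x) - T x (nabla X Y x) (Z x) - T x (Y x) (nabla X Z x)

/-- The divergence of a 2-tensor field, `(div T)(V) = ∑ᵢ (∇_{eᵢ} T)(eᵢ, V)`, where `(eᵢ)` is
an orthonormal basis of the tangent space at `x`, extended to smooth local vector fields
(the value at `x` does not depend on the extension). -/
def divTensor (T : Π x : M, TangentSpace I x →L[ℝ] TangentSpace I x →L[ℝ] ℝ)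
    (V : Π x : M, TangentSpace I x) (x : M) : ℝ :=
  ∑ i, nablaTensor T (extend E (stdOrthonormalBasis ℝ (TangentSpace I x) i))
    (extend E (stdOrthonormalBasis ℝ (TangentSpace I x) i)) V x

/-- The tensor field `χ = ‖grad f‖² Hess_f + (Δf) (g - df ⊗ df)`. -/
def chi (f : M → ℝ) (x : M) : TangentSpace I x →L[ℝ] TangentSpace I x →L[ℝ] ℝ :=
  ‖grad (I := I) f x‖ ^ 2 • hess f x
    + laplacian (I := I) f x • (metric x - (d% f x).smulRight (d% f x))

end RiemGeom

end

open RiemGeom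

noncomputable section

namespace RiemGeom

variable {E : Type*} [NormedAddCommGroup E] [NormedSpace ℝ E] [FiniteDimensional ℝ E]
  {H : Type*} [TopologicalSpace H] {I : ModelWithCorners ℝ E H}
  {M : Type*} [TopologicalSpace M] [ChartedSpace H M] [IsManifold I ∞ M]
  [RiemannianBundle (fun x : M ↦ TangentSpace I x)]
  [IsContMDiffRiemannianBundle I ∞ E (fun x : M ↦ TangentSpace I x)]

/-! ### Smoothness of the basic operations -/

/-! Apply the Leibniz rule to `χ` and trace (`nablaTensor_chi`, `divTensor_chi`). The derivative of
`‖grad f‖²` contracts with the Hessian to the first term; the derivative of `Δf` pairs with `g - df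
⊗ df`; since `g` is parallel, the derivative of `-df ⊗ df` gives `-(Δf)² df(V)` and `-Δf Hess_f(grad
f, V)`, where `Hess_f(grad f, V) = ½ V‖grad f‖²`. There remains `‖grad f‖² div Hess_f`, and the core
is `div Hess_f = dΔf + Ric(grad f, ·)` (`sum_nablaHess`).

For that, `∇Hess_f` is symmetric in its last two slots (`nablaHess_comm`), and exchanging its first
two costs a curvature term (`nablaHess_sub_nablaHess`). Tracing gives `∑ᵢ (∇_V Hess_f)(eᵢ, eᵢ)`,
which is `dΔf(V)` because the trace commutes with `∇_V` (`mvfderiv_laplacian`), plus a curvature sum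
that pair symmetry identifies with `Ric`.

The connection and the gradient are known only through their inner products with other fields. Their
smoothness is therefore read off in a local orthonormal frame (`smoothAt_of_inner`), which also
serves to differentiate the trace. -/

theorem mdiffAt_of_smooth {x : M} {X : Π x : M, TangentSpace I x}
    (hX : CMDiffAt ∞ (T% X) x) : MDiffAt (T% X) x :=
  hX.mdifferentiableAt (by simp)

theorem eventually_mdiffAt {x : M} {X : Π x : M, TangentSpace I x}
    (hX : CMDiffAt ∞ (T% X) x) : ∀ᶠ y in nhds x, MDiffAt (T% X) y := by
  have h := (contMDiffAt_iff_contMDiffAt_nhds (by simp)).1 (hX.of_le (m := 1) (by simp))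
  filter_upwards [h] with y hy
  exact hy.mdifferentiableAt (by simp)

theorem eventually_mdiffAt_fun {x : M} {u : M → ℝ}
    (hu : CMDiffAt ∞ u x) : ∀ᶠ y in nhds x, MDiffAt u y := by
  have h := (contMDiffAt_iff_contMDiffAt_nhds (by simp)).1 (hu.of_le (m := 1) (by simp))
  filter_upwards [h] with y hy
  exact hy.mdifferentiableAt (by simp)

theorem smoothAt_extend {x : M} (v : TangentSpace I x) : CMDiffAt ∞ (T% (extend E v)) x :=
  contMDiffAt_extend I E v

theorem smoothAt_inner {x : M} {X Y : Π x : M, TangentSpace I x}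
    (hX : CMDiffAt ∞ (T% X) x) (hY : CMDiffAt ∞ (T% Y) x) :
    CMDiffAt ∞ (fun y ↦ (inner ℝ (X y) (Y y) : ℝ)) x :=
  ContMDiffAt.inner_bundle (F := E) (E := fun x : M ↦ TangentSpace I x) (b := fun y ↦ y)
    (v := X) (w := Y) hX hY

theorem smoothAt_mvfderiv_apply {x : M} {u : M → ℝ} {X : Π x : M, TangentSpace I x}
    (hu : CMDiffAt ∞ u x) (hX : CMDiffAt ∞ (T% X) x) :
    CMDiffAt ∞ (fun y ↦ d% u y (X y)) x := by
  have hI : IsManifold I 1 M := IsManifold.of_le (n := ∞) (by simp)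
  -- The differential is smooth in coordinates; evaluated on `X` it is a smooth map into the tangent
  -- bundle of `ℝ`, whose fibre component is the function sought.
  have h1 := hu.mfderiv_const (m := ∞) (by simp)
  have h2 := ContMDiffAt.clm_apply_of_inCoordinates (b₁ := id) (b₂ := u) h1 hX hu
  rw [contMDiffAt_totalSpace] at h2
  simp at h2
  exact h2.2

theorem smoothAt_mlieBracket {x : M} {X Y : Π x : M, TangentSpace I x}
    (hX : CMDiffAt ∞ (T% X) x) (hY : CMDiffAt ∞ (T% Y) x) :
    CMDiffAt ∞ (T% (mlieBracket I X Y)) x := by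
  have := FiniteDimensional.complete ℝ E
  have : IsManifold I (minSmoothness ℝ 2) M :=
    IsManifold.of_le (n := ∞) (by simpa using WithTop.coe_le_coe.2 (le_top (a := (2 : ℕ∞))))
  have : IsManifold I (((⊤ : ℕ∞) : WithTop ℕ∞) + 1) M := by simpa using ‹IsManifold I ∞ M›
  exact ContMDiffAt.mlieBracket_vectorField (m := ⊤) (n := ⊤) hX hY (by simp)

theorem smoothAt_koszul {x : M} {X Y Z : Π x : M, TangentSpace I x}
    (hX : CMDiffAt ∞ (T% X) x) (hY : CMDiffAt ∞ (T% Y) x) (hZ : CMDiffAt ∞ (T% Z) x) :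
    CMDiffAt ∞ (koszul X Y Z) x :=
  (((((smoothAt_mvfderiv_apply (smoothAt_inner hY hZ) hX).add
    (smoothAt_mvfderiv_apply (smoothAt_inner hZ hX) hY)).sub
    (smoothAt_mvfderiv_apply (smoothAt_inner hX hY) hZ)).add
    (smoothAt_inner (smoothAt_mlieBracket hX hY) hZ)).sub
    (smoothAt_inner (smoothAt_mlieBracket hX hZ) hY)).sub
    (smoothAt_inner (smoothAt_mlieBracket hY hZ) hX)

/-! ### Local orthonormal frames -/

/-- Each projection coefficient is a quotient of smooth inner products. Independence at `x` alone
suffices, since smoothness at `x` only needs the denominator nonzero there. -/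
theorem smoothAt_gramSchmidt {x : M} {n : ℕ} {X : Fin n → Π x : M, TangentSpace I x}
    (hX : ∀ i, CMDiffAt ∞ (T% (X i)) x) (hli : LinearIndependent ℝ (fun i ↦ X i x)) (i : Fin n) :
    CMDiffAt ∞ (T% (fun y ↦ InnerProductSpace.gramSchmidt ℝ (fun j ↦ X j y) i)) x := by
  induction i using WellFoundedLT.induction with
  | ind i ih =>
    have key : (fun y ↦ InnerProductSpace.gramSchmidt ℝ (fun j ↦ X j y) i) =
        X i - fun y ↦ ∑ j ∈ Finset.Iio i,
          (inner ℝ (InnerProductSpace.gramSchmidt ℝ (fun j ↦ X j y) j) (X i y) /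
            inner ℝ (InnerProductSpace.gramSchmidt ℝ (fun j ↦ X j y) j)
              (InnerProductSpace.gramSchmidt ℝ (fun j ↦ X j y) j) : ℝ) •
            InnerProductSpace.gramSchmidt ℝ (fun j ↦ X j y) j := by
      funext y
      rw [InnerProductSpace.gramSchmidt_def, Pi.sub_apply]
      congr 1
      refine Finset.sum_congr rfl fun j _ ↦ ?_
      rw [Submodule.starProjection_singleton, real_inner_self_eq_norm_sq]
      rfl
    refine ContMDiffAt.congr_of_eventuallyEq ?_
      (.of_forall fun y ↦ congrArg (TotalSpace.mk' E y) (congrFun key y))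
    refine (hX i).sub_section (ContMDiffAt.sum_section fun j hj ↦ ?_)
    have hj' := ih j (Finset.mem_Iio.1 hj)
    refine ContMDiffAt.smul_section ?_ hj'
    exact (smoothAt_inner hj' (hX i)).div₀ (smoothAt_inner hj' hj')
      (inner_self_ne_zero.2 (InnerProductSpace.gramSchmidt_ne_zero j hli))

/-- An orthonormal basis of the tangent space at `x` extends to a local orthonormal frame. -/
theorem exists_orthonormalFrame {x : M} {n : ℕ}
    (b : OrthonormalBasis (Fin n) ℝ (TangentSpace I x)) :
    ∃ F : Fin n → Π x : M, TangentSpace I x, (∀ i, CMDiffAt ∞ (T% (F i)) x) ∧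
      (∀ i, F i x = b i) ∧
      ∀ᶠ y in nhds x, ∃ c : OrthonormalBasis (Fin n) ℝ (TangentSpace I y), ∀ i, c i = F i y := by
  let X : Fin n → Π x : M, TangentSpace I x := fun i ↦ extend E (b i)
  have hXx : (fun i ↦ X i x) = b := by funext i; simp [X]
  have hli : LinearIndependent ℝ (fun i ↦ X i x) := by
    rw [hXx]; exact b.orthonormal.linearIndependent
  let G : Fin n → Π x : M, TangentSpace I x :=
    fun i y ↦ InnerProductSpace.gramSchmidt ℝ (fun j ↦ X j y) i
  have hG : ∀ i, CMDiffAt ∞ (T% (G i)) x :=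
    smoothAt_gramSchmidt (fun i ↦ smoothAt_extend (b i)) hli
  have hG0 : ∀ i, inner ℝ (G i x) (G i x) ≠ (0 : ℝ) := fun i ↦
    inner_self_ne_zero.2 (InnerProductSpace.gramSchmidt_ne_zero i hli)
  -- At `x` the extended fields are already orthonormal, so Gram–Schmidt leaves them unchanged.
  have hGx : ∀ i, G i x = b i := fun i ↦ by
    have h : InnerProductSpace.gramSchmidt ℝ b = b :=
      InnerProductSpace.gramSchmidt_of_orthogonal ℝ fun i j hij ↦ b.orthonormal.2 hij
    simp only [G, hXx, h]
  refine ⟨fun i y ↦ (Real.sqrt (inner ℝ (G i y) (G i y)))⁻¹ • G i y, fun i ↦ ?_, fun i ↦ ?_, ?_⟩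
  · refine ContMDiffAt.smul_section (ContMDiffAt.inv₀ ?_ ?_) (hG i)
    · exact (Real.contDiffAt_sqrt (hG0 i)).contMDiffAt.comp x (smoothAt_inner (hG i) (hG i))
    · exact Real.sqrt_ne_zero'.2 (lt_of_le_of_ne real_inner_self_nonneg (hG0 i).symm)
  · simp [hGx]
  -- By continuity the orthogonalised fields stay nonzero near `x`, so they can be normalised there;
  -- a dimension count then makes them a basis.
  · have hev : ∀ᶠ y in nhds x, ∀ i, inner ℝ (G i y) (G i y) ≠ (0 : ℝ) :=
      Filter.eventually_all.2 fun i ↦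
        (smoothAt_inner (hG i) (hG i)).continuousAt.eventually_ne (hG0 i)
    filter_upwards [hev] with y hy
    have hon : Orthonormal ℝ (fun i ↦ (Real.sqrt (inner ℝ (G i y) (G i y)))⁻¹ • G i y) := by
      refine ⟨fun i ↦ ?_, fun i j hij ↦ ?_⟩
      · have h0 : ‖G i y‖ ≠ 0 := norm_ne_zero_iff.2 (inner_self_ne_zero.1 (hy i))
        beta_reduce
        rw [← norm_eq_sqrt_real_inner, norm_smul, norm_inv, norm_norm, inv_mul_cancel₀ h0]
      · beta_reduce
        rw [real_inner_smul_left, real_inner_smul_right,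
          InnerProductSpace.gramSchmidt_orthogonal ℝ _ hij]
        simp
    have hcard : Fintype.card (Fin n) = Module.finrank ℝ (TangentSpace I y) :=
      (Module.finrank_eq_card_basis b.toBasis).symm
    refine ⟨OrthonormalBasis.mk hon
      (hon.linearIndependent.span_eq_top_of_card_eq_finrank' hcard).ge, fun i ↦ ?_⟩
    simp

/-- A vector field is smooth if its inner products with all smooth vector fields are. -/
theorem smoothAt_of_inner {x : M} {X : Π x : M, TangentSpace I x}
    (h : ∀ Z : Π x : M, TangentSpace I x, CMDiffAt ∞ (T% Z) x →
      CMDiffAt ∞ (fun y ↦ (inner ℝ (X y) (Z y) : ℝ)) x) :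
    CMDiffAt ∞ (T% X) x := by
  obtain ⟨F, hF, -, hev⟩ := exists_orthonormalFrame (stdOrthonormalBasis ℝ (TangentSpace I x))
  have hs : CMDiffAt ∞ (T% (fun y ↦ ∑ i, (inner ℝ (X y) (F i y) : ℝ) • F i y)) x :=
    ContMDiffAt.sum_section fun i _ ↦ (h _ (hF i)).smul_section (hF i)
  refine hs.congr_of_eventuallyEq ?_
  filter_upwards [hev] with y ⟨c, hc⟩
  refine congrArg (TotalSpace.mk' E y) ?_
  simp only [← hc]
  conv_lhs => rw [← c.sum_repr' (X y)]
  simp only [real_inner_comm]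

theorem inner_grad (u : M → ℝ) (x : M) (v : TangentSpace I x) :
    inner ℝ (grad u x) v = d% u x v :=
  inner_sharp x _ v

theorem smoothAt_grad {x : M} {u : M → ℝ} (hu : CMDiffAt ∞ u x) :
    CMDiffAt ∞ (T% (grad (I := I) u)) x :=
  smoothAt_of_inner fun Z hZ ↦ by
    simp only [inner_grad]
    exact smoothAt_mvfderiv_apply hu hZ

theorem two_mul_inner_nabla {x : M} {X Y Z : Π x : M, TangentSpace I x}
    (hX : MDiffAt (T% X) x) (hY : MDiffAt (T% Y) x) (hZ : MDiffAt (T% Z) x) :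
    2 * inner ℝ (nabla X Y x) (Z x) = koszul X Y Z x :=
  two_mul_inner_leviCivita hX hY hZ

theorem smoothAt_nabla {x : M} {X Y : Π x : M, TangentSpace I x}
    (hX : CMDiffAt ∞ (T% X) x) (hY : CMDiffAt ∞ (T% Y) x) :
    CMDiffAt ∞ (T% (nabla X Y)) x :=
  smoothAt_of_inner fun Z hZ ↦ by
    refine ((contMDiffAt_const (c := (1 / 2 : ℝ))).mul
      (smoothAt_koszul hX hY hZ)).congr_of_eventuallyEq ?_
    filter_upwards [eventually_mdiffAt hX, eventually_mdiffAt hY, eventually_mdiffAt hZ]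
      with y h1 h2 h3
    rw [Pi.mul_apply, ← two_mul_inner_nabla h1 h2 h3]
    ring

theorem mvfderiv_congr {x : M} {u v : M → ℝ} (h : u =ᶠ[nhds x] v) :
    d% u x = (d% v x : TangentSpace I x →L[ℝ] ℝ) := by
  ext w
  simp only [mvfderiv]
  exact congrArg (fun L : TangentSpace I x →L[ℝ] ℝ ↦ L w) h.mfderiv_eq

/-- The Koszul expression involves `Y` only through its value, derivatives and brackets, all
determined by the germ of `Y` at `x`. -/
theorem nabla_congr_right {x : M} {X Y Y' : Π x : M, TangentSpace I x}
    (hX : MDiffAt (T% X) x) (hY : MDiffAt (T% Y) x) (hY' : MDiffAt (T% Y') x)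
    (h : ∀ᶠ y in nhds x, Y y = Y' y) : nabla X Y x = nabla X Y' x := by
  refine ext_inner_right ℝ fun w ↦ ?_
  have hw := mdifferentiableAt_extend I E w
  have h1 := two_mul_inner_nabla hX hY hw
  have h2 := two_mul_inner_nabla hX hY' hw
  have hx := h.self_of_nhds
  have e1 : (fun y ↦ (inner ℝ (Y y) (extend E w y) : ℝ)) =ᶠ[nhds x]
      fun y ↦ inner ℝ (Y' y) (extend E w y) := h.mono fun y hy ↦ by simp only [hy]
  have e2 : (fun y ↦ (inner ℝ (X y) (Y y) : ℝ)) =ᶠ[nhds x]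
      fun y ↦ inner ℝ (X y) (Y' y) := h.mono fun y hy ↦ by simp only [hy]
  have e3 : mlieBracket I X Y x = mlieBracket I X Y' x :=
    Filter.EventuallyEq.mlieBracket_vectorField_eq Filter.EventuallyEq.rfl h
  have e4 : mlieBracket I Y (extend E w) x = mlieBracket I Y' (extend E w) x :=
    Filter.EventuallyEq.mlieBracket_vectorField_eq h Filter.EventuallyEq.rfl
  rw [koszul, mvfderiv_congr e1, mvfderiv_congr e2, e3, e4, hx, ← koszul] at h1
  simp only [extend_apply_self] at h1 h2
  linarith

/-! ### Derivations, brackets and curvature -/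

/-- A chart-free argument: in the Jacobi identity for `X`, `Y`, `u • Z`, the coefficient of `Z` is
exactly the defect of this formula. -/
theorem mvfderiv_mlieBracket {x : M} {u : M → ℝ} {X Y : Π x : M, TangentSpace I x}
    (hu : CMDiffAt ∞ u x) (hX : CMDiffAt ∞ (T% X) x) (hY : CMDiffAt ∞ (T% Y) x) :
    d% u x (mlieBracket I X Y x) =
      d% (fun y ↦ d% u y (Y y)) x (X x) - d% (fun y ↦ d% u y (X y)) x (Y x) := by
  have := FiniteDimensional.complete ℝ E
  have : IsManifold I (minSmoothness ℝ 2) M :=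
    IsManifold.of_le (n := ∞) (by simpa using WithTop.coe_le_coe.2 (le_top (a := (2 : ℕ∞))))
  have : IsManifold I (minSmoothness ℝ 3) M :=
    IsManifold.of_le (n := ∞) (by simpa using WithTop.coe_le_coe.2 (le_top (a := (3 : ℕ∞))))
  rcases subsingleton_or_nontrivial (TangentSpace I x) with hs | hs
  -- In dimension zero no nonvanishing `Z` exists, but every term is zero.
  · rw [Subsingleton.elim (mlieBracket I X Y x) 0, Subsingleton.elim (X x) 0,
      Subsingleton.elim (Y x) 0]
    simp
  obtain ⟨v, hv⟩ := exists_ne (0 : TangentSpace I x)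
  -- compare the two sides of the Jacobi identity for `X`, `Y` and `u • Z`, where `Z x ≠ 0`
  set Z : Π x : M, TangentSpace I x := extend E v with hZdef
  have hZ : CMDiffAt ∞ (T% Z) x := smoothAt_extend v
  have two_le : minSmoothness ℝ 2 ≤ (∞ : WithTop ℕ∞) := by
    simpa using WithTop.coe_le_coe.2 (le_top (a := (2 : ℕ∞)))
  have bracket_smul : ∀ {W : Π x : M, TangentSpace I x}, CMDiffAt ∞ (T% W) x →
      mlieBracket I W (u • Z) =ᶠ[nhds x]
        (fun y ↦ d% u y (W y)) • Z + u • mlieBracket I W Z := by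
    intro W hW
    filter_upwards [eventually_mdiffAt_fun hu, eventually_mdiffAt hZ] with y h1 h2
    exact mlieBracket_smul_right h1 h2
  have double : ∀ {W W' : Π x : M, TangentSpace I x}, CMDiffAt ∞ (T% W) x →
      CMDiffAt ∞ (T% W') x → mlieBracket I W' (mlieBracket I W (u • Z)) x =
        d% (fun y ↦ d% u y (W y)) x (W' x) • Z x + d% u x (W x) • mlieBracket I W' Z x +
        (d% u x (W' x) • mlieBracket I W Z x + u x • mlieBracket I W' (mlieBracket I W Z) x) := by
    intro W W' hW hW'
    have hd := smoothAt_mvfderiv_apply hu hW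
    have hb := smoothAt_mlieBracket hW hZ
    have he : mlieBracket I W' (mlieBracket I W (u • Z)) x =
        mlieBracket I W' ((fun y ↦ d% u y (W y)) • Z + u • mlieBracket I W Z) x :=
      Filter.EventuallyEq.mlieBracket_vectorField_eq Filter.EventuallyEq.rfl (bracket_smul hW)
    rw [he, mlieBracket_add_right (mdiffAt_of_smooth (hd.smul_section hZ))
        (mdiffAt_of_smooth (hu.smul_section hb)),
      mlieBracket_smul_right (hd.mdifferentiableAt (by simp)) (mdiffAt_of_smooth hZ),
      mlieBracket_smul_right (hu.mdifferentiableAt (by simp)) (mdiffAt_of_smooth hb)]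
  have j1 := leibniz_identity_mlieBracket_apply (hX.of_le two_le) (hY.of_le two_le)
    ((hu.smul_section hZ).of_le two_le)
  have j2 := leibniz_identity_mlieBracket_apply (hX.of_le two_le) (hY.of_le two_le)
    (hZ.of_le two_le)
  rw [double hY hX, double hX hY, (bracket_smul (smoothAt_mlieBracket hX hY)).self_of_nhds,
    j2] at j1
  simp only [Pi.add_apply, Pi.smul_apply', smul_add] at j1
  -- The products of a first derivative of `u` with a bracket are symmetric in `X` and `Y` and
  -- cancel; the terms with undifferentiated `u` cancel by Jacobi for `X`, `Y`, `Z`.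
  have j3 : (d% (fun y ↦ d% u y (Y y)) x (X x) - d% (fun y ↦ d% u y (X y)) x (Y x)
      - d% u x (mlieBracket I X Y x)) • Z x = 0 := by
    rw [sub_smul, sub_smul]
    linear_combination (norm := module) j1
  have hZx : Z x ≠ 0 := by simpa [hZdef] using hv
  have := (smul_eq_zero.1 j3).resolve_right hZx
  linarith

theorem nabla_sub_nabla {x : M} {X Y : Π x : M, TangentSpace I x}
    (hX : MDiffAt (T% X) x) (hY : MDiffAt (T% Y) x) :
    nabla X Y x - nabla Y X x = mlieBracket I X Y x := by
  have := FiniteDimensional.complete ℝ E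
  exact (CovariantDerivative.torsion_eq_zero_iff _).1 leviCivita_torsion hX hY

theorem nabla_sub_right {x : M} {X Y Y' : Π x : M, TangentSpace I x}
    (hY' : MDiffAt (T% Y') x) (hs : MDiffAt (T% (Y - Y')) x) :
    nabla X (Y - Y') x = nabla X Y x - nabla X Y' x := by
  have h := (leviCivita (I := I) (M := M)).isCovariantDerivativeOnUniv.add hs hY'
  rw [sub_add_cancel] at h
  rw [eq_sub_iff_add_eq]
  exact (congrArg (fun L : TangentSpace I x →L[ℝ] TangentSpace I x ↦ L (X x)) h).symm

/-- Torsion-freeness holds on a neighbourhood of `x`, so it may be differentiated. -/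
theorem nabla_nabla_sub {x : M} {X Y Z : Π x : M, TangentSpace I x}
    (hX : CMDiffAt ∞ (T% X) x) (hY : CMDiffAt ∞ (T% Y) x) (hZ : CMDiffAt ∞ (T% Z) x) :
    nabla X (nabla Y Z) x - nabla X (nabla Z Y) x = nabla X (mlieBracket I Y Z) x := by
  have h1 := smoothAt_nabla hY hZ
  have h2 := smoothAt_nabla hZ hY
  have h3 := h1.sub_section h2
  rw [← nabla_sub_right (mdiffAt_of_smooth h2) (mdiffAt_of_smooth h3)]
  refine nabla_congr_right (mdiffAt_of_smooth hX) (mdiffAt_of_smooth h3)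
    (mdiffAt_of_smooth (smoothAt_mlieBracket hY hZ)) ?_
  filter_upwards [eventually_mdiffAt hY, eventually_mdiffAt hZ] with y h4 h5
  exact nabla_sub_nabla h4 h5

theorem mvfderiv_inner {x : M} {X Y Z : Π x : M, TangentSpace I x}
    (hX : CMDiffAt ∞ (T% X) x) (hY : CMDiffAt ∞ (T% Y) x) (hZ : CMDiffAt ∞ (T% Z) x) :
    d% (fun y ↦ inner ℝ (Y y) (Z y)) x (X x) =
      inner ℝ (nabla X Y x) (Z x) + inner ℝ (Y x) (nabla X Z x) :=
  leviCivita_metric (mdiffAt_of_smooth hX) (mdiffAt_of_smooth hY) (mdiffAt_of_smooth hZ)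

/-- The first Bianchi identity. -/
theorem curvature_bianchi {x : M} {X Y Z : Π x : M, TangentSpace I x}
    (hX : CMDiffAt ∞ (T% X) x) (hY : CMDiffAt ∞ (T% Y) x) (hZ : CMDiffAt ∞ (T% Z) x) :
    curvature X Y Z x + curvature Y Z X x + curvature Z X Y x = 0 := by
  have := FiniteDimensional.complete ℝ E
  have : IsManifold I (minSmoothness ℝ 3) M :=
    IsManifold.of_le (n := ∞) (by simpa using WithTop.coe_le_coe.2 (le_top (a := (3 : ℕ∞))))
  have two_le : minSmoothness ℝ 2 ≤ (∞ : WithTop ℕ∞) := by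
    simpa using WithTop.coe_le_coe.2 (le_top (a := (2 : ℕ∞)))
  -- Using torsion-freeness twice, the cyclic sum regroups into iterated brackets, which vanish by
  -- Jacobi.
  have key : ∀ {A B C : Π x : M, TangentSpace I x}, CMDiffAt ∞ (T% A) x → CMDiffAt ∞ (T% B) x →
      CMDiffAt ∞ (T% C) x → nabla A (nabla B C) x - nabla A (nabla C B) x
        - nabla (mlieBracket I B C) A x = mlieBracket I A (mlieBracket I B C) x := by
    intro A B C hA hB hC
    rw [nabla_nabla_sub hA hB hC]
    exact nabla_sub_nabla (mdiffAt_of_smooth hA) (mdiffAt_of_smooth (smoothAt_mlieBracket hB hC))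
  have k1 := key hX hY hZ
  have k2 := key hY hZ hX
  have k3 := key hZ hX hY
  have j := leibniz_identity_mlieBracket_apply (hX.of_le two_le) (hY.of_le two_le) (hZ.of_le two_le)
  have s1 : mlieBracket I (mlieBracket I X Y) Z x = - mlieBracket I Z (mlieBracket I X Y) x :=
    mlieBracket_swap_apply
  have s2 : mlieBracket I Y (mlieBracket I X Z) x = - mlieBracket I Y (mlieBracket I Z X) x := by
    have h : mlieBracket I X Z = (-1 : ℝ) • mlieBracket I Z X := by
      rw [mlieBracket_swap]; simp
    rw [h, mlieBracket_const_smul_right (mdiffAt_of_smooth (smoothAt_mlieBracket hZ hX))]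
    simp
  rw [s1, s2] at j
  simp only [curvature]
  linear_combination (norm := module) k1 + k2 + k3 + j

theorem curvature_swap {x : M} (X Y Z : Π x : M, TangentSpace I x) :
    curvature Y X Z x = - curvature X Y Z x := by
  have h : nabla (mlieBracket I Y X) Z x = - nabla (mlieBracket I X Y) Z x := by
    simp only [nabla]
    rw [mlieBracket_swap_apply, map_neg]
  simp only [curvature, h]
  abel

/-- Let `[X, Y] = XY - YX` act on `g(Z, W)` and expand by metric compatibility: the mixed terms are
symmetric in `X`, `Y` and cancel. -/
theorem inner_curvature_swap {x : M} {X Y Z W : Π x : M, TangentSpace I x}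
    (hX : CMDiffAt ∞ (T% X) x) (hY : CMDiffAt ∞ (T% Y) x) (hZ : CMDiffAt ∞ (T% Z) x)
    (hW : CMDiffAt ∞ (T% W) x) :
    inner ℝ (curvature X Y Z x) (W x) = - inner ℝ (curvature X Y W x) (Z x) := by
  have second : ∀ {A B : Π x : M, TangentSpace I x}, CMDiffAt ∞ (T% A) x → CMDiffAt ∞ (T% B) x →
      d% (fun y ↦ d% (fun z ↦ inner ℝ (Z z) (W z)) y (B y)) x (A x) =
        inner ℝ (nabla A (nabla B Z) x) (W x) + inner ℝ (nabla B Z x) (nabla A W x) +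
        (inner ℝ (nabla A Z x) (nabla B W x) + inner ℝ (Z x) (nabla A (nabla B W) x)) := by
    intro A B hA hB
    have h1 := smoothAt_nabla hB hZ
    have h2 := smoothAt_nabla hB hW
    have he : (fun y ↦ d% (fun z ↦ inner ℝ (Z z) (W z)) y (B y)) =ᶠ[nhds x]
        fun y ↦ inner ℝ (nabla B Z y) (W y) + inner ℝ (Z y) (nabla B W y) := by
      filter_upwards [eventually_mdiffAt hB, eventually_mdiffAt hZ, eventually_mdiffAt hW]
        with y h3 h4 h5
      exact leviCivita_metric h3 h4 h5
    rw [mvfderiv_congr he, mvfderiv_fun_add ((smoothAt_inner h1 hW).mdifferentiableAt (by simp))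
      ((smoothAt_inner hZ h2).mdifferentiableAt (by simp)), add_apply,
      mvfderiv_inner hA h1 hW, mvfderiv_inner hA hZ h2]
  have h := mvfderiv_mlieBracket (smoothAt_inner hZ hW) hX hY
  rw [second hX hY, second hY hX, mvfderiv_inner (smoothAt_mlieBracket hX hY) hZ hW] at h
  simp only [curvature, inner_sub_left]
  simp only [real_inner_comm (Z x)] at h ⊢
  linarith

/-- The pair symmetry of the curvature tensor. -/
theorem inner_curvature_pair {x : M} {X Y Z W : Π x : M, TangentSpace I x}
    (hX : CMDiffAt ∞ (T% X) x) (hY : CMDiffAt ∞ (T% Y) x) (hZ : CMDiffAt ∞ (T% Z) x)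
    (hW : CMDiffAt ∞ (T% W) x) :
    inner ℝ (curvature X Y Z x) (W x) = inner ℝ (curvature Z W X x) (Y x) := by
  have bianchi : ∀ {A B C D : Π x : M, TangentSpace I x}, CMDiffAt ∞ (T% A) x →
      CMDiffAt ∞ (T% B) x → CMDiffAt ∞ (T% C) x →
      inner ℝ (curvature A B C x) (D x) + inner ℝ (curvature B C A x) (D x)
        + inner ℝ (curvature C A B x) (D x) = 0 := by
    intro A B C D hA hB hC
    rw [← inner_add_left, ← inner_add_left, curvature_bianchi hA hB hC, inner_zero_left]
  have swap : ∀ A B C D : Π x : M, TangentSpace I x,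
      inner ℝ (curvature B A C x) (D x) = - inner ℝ (curvature A B C x) (D x) := by
    intro A B C D
    rw [curvature_swap, inner_neg_left]
  -- The classical octahedron argument: the four Bianchi identities on cyclic shifts of `X, Y, Z,
  -- W`, combined with both skew symmetries.
  have b1 := bianchi (D := W) hX hY hZ
  have b2 := bianchi (D := X) hY hZ hW
  have b3 := bianchi (D := Y) hZ hW hX
  have b4 := bianchi (D := Z) hW hX hY
  linarith [inner_curvature_swap hX hY hZ hW, inner_curvature_swap hY hZ hX hW,
    inner_curvature_swap hZ hX hY hW, inner_curvature_swap hZ hW hY hX,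
    inner_curvature_swap hW hY hZ hX, inner_curvature_swap hW hX hZ hY,
    swap X Y W Z, swap Y Z W X, swap Z X Y W, swap Z X W Y, swap Z W X Y, swap W Y X Z,
    swap W Y Z X, swap W X Y Z, swap W X Z Y]

/-! ### The Hessian and its covariant derivative -/

/-- The antisymmetric part is `[v, w]u - du(∇_v w - ∇_w v)`, which vanishes without torsion. Only
values at `x` enter, so arbitrary `X` and `Y` may be replaced by smooth extensions. -/
theorem inner_nabla_grad_comm {u : M → ℝ} (hu : ContMDiff I 𝓘(ℝ) ∞ u)
    (X Y : Π x : M, TangentSpace I x) (x : M) :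
    inner ℝ (nabla X (grad u) x) (Y x) = inner ℝ (nabla Y (grad u) x) (X x) := by
  suffices h : ∀ v w : TangentSpace I x, inner ℝ (leviCivita (grad u) x v) w =
      inner ℝ (leviCivita (grad u) x w) v from h _ _
  intro v w
  have hG := smoothAt_grad (I := I) (hu x)
  have hv := smoothAt_extend (I := I) v
  have hw := smoothAt_extend (I := I) w
  have h1 := mvfderiv_inner hv hG hw
  have h2 := mvfderiv_inner hw hG hv
  have h3 := mvfderiv_mlieBracket (hu x) hv hw
  have h4 := nabla_sub_nabla (mdiffAt_of_smooth hv) (mdiffAt_of_smooth hw)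
  rw [← h4, map_sub] at h3
  simp only [inner_grad, nabla, extend_apply_self] at h1 h2 h3
  linarith

/-- The second covariant derivative of `grad u`, paired with `Z`; this is `(∇_X Hess_u)(Y, Z)`. -/
def nablaHess (u : M → ℝ) (X Y Z : Π x : M, TangentSpace I x) (x : M) : ℝ :=
  inner ℝ (nabla X (nabla Y (grad u)) x - nabla (nabla X Y) (grad u) x) (Z x)

theorem mvfderiv_inner_nabla_grad {x : M} {u : M → ℝ} (hu : ContMDiff I 𝓘(ℝ) ∞ u)
    {X Y Z : Π x : M, TangentSpace I x} (hX : CMDiffAt ∞ (T% X) x) (hY : CMDiffAt ∞ (T% Y) x)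
    (hZ : CMDiffAt ∞ (T% Z) x) :
    d% (fun y ↦ inner ℝ (nabla Y (grad u) y) (Z y)) x (X x) =
      nablaHess u X Y Z x + inner ℝ (nabla (nabla X Y) (grad u) x) (Z x)
        + inner ℝ (nabla Y (grad u) x) (nabla X Z x) := by
  rw [mvfderiv_inner hX (smoothAt_nabla hY (smoothAt_grad (hu x))) hZ, nablaHess, inner_sub_left]
  ring

/-- This is the derivative of the symmetry of the Hessian. -/
theorem nablaHess_comm {x : M} {u : M → ℝ} (hu : ContMDiff I 𝓘(ℝ) ∞ u)
    {X Y Z : Π x : M, TangentSpace I x} (hX : CMDiffAt ∞ (T% X) x) (hY : CMDiffAt ∞ (T% Y) x)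
    (hZ : CMDiffAt ∞ (T% Z) x) : nablaHess u X Y Z x = nablaHess u X Z Y x := by
  have h1 := mvfderiv_inner_nabla_grad hu hX hY hZ
  have h2 := mvfderiv_inner_nabla_grad hu hX hZ hY
  have h3 : (fun y ↦ inner ℝ (nabla Y (grad u) y) (Z y)) =
      fun y ↦ (inner ℝ (nabla Z (grad u) y) (Y y) : ℝ) := funext (inner_nabla_grad_comm hu Y Z)
  rw [h3] at h1
  linarith [inner_nabla_grad_comm hu (nabla X Y) Z x, inner_nabla_grad_comm hu (nabla X Z) Y x]

/-- The Ricci identity: without torsion, the two correction terms `∇_{∇_X Y}` and `∇_{∇_Y X}`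
combine into `∇_{[X,Y]}`. -/
theorem nablaHess_sub_nablaHess {x : M} (u : M → ℝ) {X Y : Π x : M, TangentSpace I x}
    (hX : CMDiffAt ∞ (T% X) x) (hY : CMDiffAt ∞ (T% Y) x) (Z : Π x : M, TangentSpace I x) :
    nablaHess u X Y Z x - nablaHess u Y X Z x = inner ℝ (curvature X Y (grad u) x) (Z x) := by
  have h : nabla (mlieBracket I X Y) (grad u) x =
      nabla (nabla X Y) (grad u) x - nabla (nabla Y X) (grad u) x := by
    have h4 := nabla_sub_nabla (mdiffAt_of_smooth hX) (mdiffAt_of_smooth hY)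
    simp only [nabla] at h4 ⊢
    rw [← h4, map_sub]
  simp only [nablaHess, curvature, h, inner_sub_left]
  ring

/-- Dependence on the last slot is pointwise by definition; symmetry carries this over to the middle
slot. It allows a frame to be exchanged for the extensions of its values at `x`. -/
theorem nablaHess_congr {x : M} {u : M → ℝ} (hu : ContMDiff I 𝓘(ℝ) ∞ u)
    {X Y Y' Z Z' : Π x : M, TangentSpace I x} (hX : CMDiffAt ∞ (T% X) x)
    (hY : CMDiffAt ∞ (T% Y) x) (hY' : CMDiffAt ∞ (T% Y') x)
    (hZ' : CMDiffAt ∞ (T% Z') x) (hYY' : Y x = Y' x) (hZZ' : Z x = Z' x) :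
    nablaHess u X Y Z x = nablaHess u X Y' Z' x := by
  have h1 : nablaHess u X Y Z x = nablaHess u X Y Z' x := by simp only [nablaHess, hZZ']
  have h2 : nablaHess u X Z' Y x = nablaHess u X Z' Y' x := by simp only [nablaHess, hYY']
  rw [h1, nablaHess_comm hu hX hY hZ', h2, nablaHess_comm hu hX hZ' hY']

theorem laplacian_eq_sum {n : ℕ} (u : M → ℝ) {x : M}
    (b : OrthonormalBasis (Fin n) ℝ (TangentSpace I x)) :
    laplacian (I := I) u x = ∑ i, inner ℝ (leviCivita (grad u) x (b i)) (b i) := by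
  rw [laplacian, LinearMap.trace_eq_sum_inner _ b]
  exact Finset.sum_congr rfl fun i _ ↦ real_inner_comm _ _

/-- Needed on a neighbourhood, not just at `x`, so that the trace can be differentiated. -/
theorem laplacian_eventuallyEq (u : M → ℝ) {x : M} {n : ℕ} {F : Fin n → Π x : M, TangentSpace I x}
    (hF : ∀ᶠ y in nhds x, ∃ c : OrthonormalBasis (Fin n) ℝ (TangentSpace I y), ∀ i, c i = F i y) :
    laplacian (I := I) u =ᶠ[nhds x]
      fun y ↦ ∑ i, (inner ℝ (nabla (F i) (grad u) y) (F i y) : ℝ) := by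
  filter_upwards [hF] with y ⟨c, hc⟩
  rw [laplacian_eq_sum u c]
  simp only [hc, nabla]

theorem smoothAt_laplacian {u : M → ℝ} (hu : ContMDiff I 𝓘(ℝ) ∞ u) (x : M) :
    CMDiffAt ∞ (laplacian (I := I) u) x := by
  obtain ⟨F, hF, -, hev⟩ := exists_orthonormalFrame (stdOrthonormalBasis ℝ (TangentSpace I x))
  refine ContMDiffAt.congr_of_eventuallyEq ?_ (laplacian_eventuallyEq u hev)
  exact contMDiffAt_finsetSum fun i _ ↦
    smoothAt_inner (smoothAt_nabla (hF i) (smoothAt_grad (hu x))) (hF i)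

theorem mvfderiv_finset_sum {x : M} {ι : Type*} (s : Finset ι) {φ : ι → M → ℝ}
    (hφ : ∀ i ∈ s, CMDiffAt ∞ (φ i) x) (v : TangentSpace I x) :
    d% (fun y ↦ ∑ i ∈ s, φ i y) x v = ∑ i ∈ s, d% (φ i) x v := by
  classical
  induction s using Finset.induction_on with
  | empty => simp [mvfderiv_const]
  | insert a s ha ih =>
    have h1 := hφ a (Finset.mem_insert_self a s)
    have h2 : CMDiffAt ∞ (fun y ↦ ∑ i ∈ s, φ i y) x :=
      contMDiffAt_finsetSum fun i hi ↦ hφ i (Finset.mem_insert_of_mem hi)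
    simp only [Finset.sum_insert ha]
    rw [mvfderiv_fun_add (h1.mdifferentiableAt (by simp)) (h2.mdifferentiableAt (by simp)),
      add_apply, ih fun i hi ↦ hφ i (Finset.mem_insert_of_mem hi)]

/-- `dΔu(V) = ∑ᵢ (∇_V Hess_u)(eᵢ, eᵢ)`. -/
theorem mvfderiv_laplacian {x : M} {u : M → ℝ} (hu : ContMDiff I 𝓘(ℝ) ∞ u)
    {V : Π x : M, TangentSpace I x} (hV : CMDiffAt ∞ (T% V) x) {n : ℕ}
    (b : OrthonormalBasis (Fin n) ℝ (TangentSpace I x)) :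
    d% (laplacian (I := I) u) x (V x) =
      ∑ i, nablaHess u V (extend E (b i)) (extend E (b i)) x := by
  obtain ⟨F, hF, hFx, hev⟩ := exists_orthonormalFrame b
  have hG := smoothAt_grad (I := I) (hu x)
  rw [mvfderiv_congr (laplacian_eventuallyEq u hev), mvfderiv_finset_sum _
    fun i _ ↦ smoothAt_inner (smoothAt_nabla (hF i) hG) (hF i)]
  -- By symmetry of the Hessian the two corrections from `∇_V Fᵢ` coincide, whence the factor 2.
  have hterm : ∀ i, d% (fun y ↦ (inner ℝ (nabla (F i) (grad u) y) (F i y) : ℝ)) x (V x) =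
      nablaHess u V (extend E (b i)) (extend E (b i)) x +
        2 * inner ℝ (leviCivita (grad u) x (b i)) (nabla V (F i) x) := by
    intro i
    have hb := smoothAt_extend (I := I) (b i)
    have hbx : extend E (b i) x = F i x := by rw [hFx, extend_apply_self]
    rw [mvfderiv_inner_nabla_grad hu hV (hF i) (hF i),
      inner_nabla_grad_comm hu (nabla V (F i)) (F i),
      nablaHess_congr hu hV hb (hF i) (hF i) hbx hbx]
    simp only [nabla, hFx]
    ring
  -- Differentiating `g(Fᵢ, Fⱼ) = δᵢⱼ` along `V` shows that the connection coefficients are skew.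
  have hskew : ∀ i j, inner ℝ (b i) (nabla V (F j) x) + inner ℝ (b j) (nabla V (F i) x) =
      (0 : ℝ) := by
    intro i j
    have hconst : (fun y ↦ (inner ℝ (F i y) (F j y) : ℝ)) =ᶠ[nhds x]
        fun _ ↦ if i = j then 1 else 0 := by
      filter_upwards [hev] with y ⟨c, hc⟩
      rw [← hc, ← hc]
      exact orthonormal_iff_ite.1 c.orthonormal i j
    have h := mvfderiv_inner hV (hF i) (hF j)
    rw [mvfderiv_congr hconst, mvfderiv_const, hFx, hFx, real_inner_comm] at h
    simp only [zero_apply] at h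
    linarith
  have hzero : ∑ i, inner ℝ (leviCivita (grad u) x (b i)) (nabla V (F i) x) = (0 : ℝ) := by
    have h1 : ∀ i, inner ℝ (leviCivita (grad u) x (b i)) (nabla V (F i) x) =
        ∑ j, inner ℝ (leviCivita (grad u) x (b i)) (b j) * inner ℝ (b j) (nabla V (F i) x) :=
      fun i ↦ (b.sum_inner_mul_inner _ _).symm
    have h2 : ∀ i j, inner ℝ (leviCivita (grad u) x (b i)) (b j) =
        (inner ℝ (leviCivita (grad u) x (b j)) (b i) : ℝ) := fun i j ↦ by
      have := inner_nabla_grad_comm hu (extend E (b i)) (extend E (b j)) x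
      simpa only [nabla, extend_apply_self] using this
    -- A symmetric matrix contracted with a skew one: exchanging indices shows that the sum equals
    -- its own negative.
    have h3 : ∑ i, inner ℝ (leviCivita (grad u) x (b i)) (nabla V (F i) x) =
        -∑ i, (inner ℝ (leviCivita (grad u) x (b i)) (nabla V (F i) x) : ℝ) := by
      simp only [h1]
      conv_lhs => rw [Finset.sum_comm]
      simp only [← Finset.sum_neg_distrib]
      refine Finset.sum_congr rfl fun i _ ↦ Finset.sum_congr rfl fun j _ ↦ ?_
      rw [h2 j i]
      linear_combination inner ℝ (leviCivita (grad u) x (b i)) (b j) * hskew i j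
    linarith
  simp only [hterm, Finset.sum_add_distrib, ← Finset.mul_sum, hzero]
  ring

/-- `div Hess_u = dΔu + Ric(grad u, ·)`. -/
theorem sum_nablaHess {x : M} {u : M → ℝ} (hu : ContMDiff I 𝓘(ℝ) ∞ u)
    {V : Π x : M, TangentSpace I x} (hV : CMDiffAt ∞ (T% V) x) :
    ∑ i, nablaHess u (extend E (stdOrthonormalBasis ℝ (TangentSpace I x) i))
      (extend E (stdOrthonormalBasis ℝ (TangentSpace I x) i)) V x =
    d% (laplacian (I := I) u) x (V x) + ricci (grad u) V x := by
  rw [mvfderiv_laplacian hu hV (stdOrthonormalBasis ℝ (TangentSpace I x)), ricci,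
    ← Finset.sum_add_distrib]
  refine Finset.sum_congr rfl fun i _ ↦ ?_
  set X : Π x : M, TangentSpace I x := extend E (stdOrthonormalBasis ℝ (TangentSpace I x) i)
    with hXdef
  have hX : CMDiffAt ∞ (T% X) x := smoothAt_extend _
  have hG := smoothAt_grad (I := I) (hu x)
  have hXx : stdOrthonormalBasis ℝ (TangentSpace I x) i = X x := by rw [hXdef, extend_apply_self]
  -- Summand by summand: `g(R(X, grad u)V, X) = g(R(V, X)X, grad u) = g(R(X, V)grad u, X)`, the
  -- curvature term of the Ricci identity.
  rw [hXx, nablaHess_comm hu hX hX hV, inner_curvature_pair hX hG hV hX,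
    inner_curvature_swap hV hX hX hG, curvature_swap, inner_neg_left, neg_neg,
    ← nablaHess_sub_nablaHess u hX hV X]
  ring

/-! ### The divergence of `χ` -/

theorem chi_apply (u : M → ℝ) (x : M) (X Y : Π x : M, TangentSpace I x) :
    chi u x (X x) (Y x) =
      inner ℝ (grad (I := I) u x) (grad u x) * inner ℝ (nabla X (grad u) x) (Y x)
      + laplacian (I := I) u x *
        (inner ℝ (X x) (Y x) - inner ℝ (grad u x) (X x) * inner ℝ (grad u x) (Y x)) := by
  simp [chi, hess, metric_apply, nabla, inner_grad]

/-- All terms containing `∇_X Y` or `∇_X Z` cancel against the corrections in `nablaTensor`. -/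
theorem nablaTensor_chi {x : M} {u : M → ℝ} (hu : ContMDiff I 𝓘(ℝ) ∞ u)
    {X Y Z : Π x : M, TangentSpace I x} (hX : CMDiffAt ∞ (T% X) x) (hY : CMDiffAt ∞ (T% Y) x)
    (hZ : CMDiffAt ∞ (T% Z) x) :
    nablaTensor (chi u) X Y Z x =
      d% (fun y ↦ inner ℝ (grad (I := I) u y) (grad u y)) x (X x) *
          inner ℝ (nabla Y (grad u) x) (Z x)
      + inner ℝ (grad (I := I) u x) (grad u x) * nablaHess u X Y Z x
      + d% (laplacian (I := I) u) x (X x) *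
        (inner ℝ (Y x) (Z x) - inner ℝ (grad u x) (Y x) * inner ℝ (grad u x) (Z x))
      - laplacian (I := I) u x * (inner ℝ (nabla X (grad u) x) (Y x) * inner ℝ (grad u x) (Z x)
        + inner ℝ (grad u x) (Y x) * inner ℝ (nabla X (grad u) x) (Z x)) := by
  have hG := smoothAt_grad (I := I) (hu x)
  have hL := smoothAt_laplacian (I := I) hu x
  have hN := smoothAt_inner hG hG
  have hH := smoothAt_inner (smoothAt_nabla hY hG) hZ
  have hYZ := smoothAt_inner hY hZ
  have hGY := smoothAt_inner hG hY
  have hGZ := smoothAt_inner hG hZ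
  have hP : CMDiffAt ∞ (fun y ↦ (inner ℝ (grad u y) (Y y) * inner ℝ (grad u y) (Z y) : ℝ)) x :=
    hGY.mul hGZ
  have hQ : CMDiffAt ∞ (fun y ↦ (inner ℝ (Y y) (Z y) -
      inner ℝ (grad u y) (Y y) * inner ℝ (grad u y) (Z y) : ℝ)) x := hYZ.sub hP
  have hNH : CMDiffAt ∞ (fun y ↦ (inner ℝ (grad (I := I) u y) (grad u y) *
      inner ℝ (nabla Y (grad u) y) (Z y) : ℝ)) x := hN.mul hH
  have hLQ : CMDiffAt ∞ (fun y ↦ laplacian (I := I) u y * (inner ℝ (Y y) (Z y) -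
      inner ℝ (grad u y) (Y y) * inner ℝ (grad u y) (Z y) : ℝ)) x := hL.mul hQ
  have md : ∀ {φ : M → ℝ}, CMDiffAt ∞ φ x → MDiffAt φ x := fun h ↦ h.mdifferentiableAt (by simp)
  rw [nablaTensor]
  simp only [chi_apply]
  rw [mvfderiv_fun_add (md hNH) (md hLQ), mvfderiv_fun_mul (md hN) (md hH),
    mvfderiv_fun_mul (md hL) (md hQ), mvfderiv_fun_sub (md hYZ) (md hP),
    mvfderiv_fun_mul (md hGY) (md hGZ)]
  simp only [add_apply, sub_apply, smul_apply, smul_eq_mul]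
  rw [mvfderiv_inner_nabla_grad hu hX hY hZ, mvfderiv_inner hX hY hZ, mvfderiv_inner hX hG hY,
    mvfderiv_inner hX hG hZ]
  ring

theorem divTensor_chi {u : M → ℝ} (hu : ContMDiff I 𝓘(ℝ) ∞ u) {V : Π x : M, TangentSpace I x}
    {x : M} (hV : CMDiffAt ∞ (T% V) x) :
    divTensor (chi (I := I) u) V x =
      inner ℝ (nabla V (grad u) x) (grad (fun y ↦ ‖grad (I := I) u y‖ ^ 2) x)
      + ‖grad (I := I) u x‖ ^ 2 * ricci (grad u) V x
      + (1 + ‖grad (I := I) u x‖ ^ 2) * inner ℝ (grad (laplacian (I := I) u) x) (V x)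
      - inner ℝ (grad (I := I) (laplacian (I := I) u) x) (grad u x) * inner ℝ (V x) (grad u x)
      - laplacian (I := I) u x ^ 2 * inner ℝ (V x) (grad u x)
      - 1 / 2 * laplacian (I := I) u x
          * inner ℝ (V x) (grad (fun y ↦ ‖grad (I := I) u y‖ ^ 2) x) := by
  have hG := smoothAt_grad (I := I) (hu x)
  set b := stdOrthonormalBasis ℝ (TangentSpace I x) with hb
  simp only [← real_inner_self_eq_norm_sq]
  set N : M → ℝ := fun y ↦ inner ℝ (grad (I := I) u y) (grad u y) with hNdef
  -- Apart from the Hessian divergence and the trace giving `Δu`, each summand is put in the form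
  -- `⟨a, bᵢ⟩⟨bᵢ, c⟩`, up to a factor independent of `i`, so that Parseval sums it.
  have hterm : ∀ i, nablaTensor (chi u) (extend E (b i)) (extend E (b i)) V x =
      inner ℝ (grad N x) (b i) * inner ℝ (b i) (nabla V (grad u) x)
      + N x * nablaHess u (extend E (b i)) (extend E (b i)) V x
      + inner ℝ (grad (laplacian (I := I) u) x) (b i) * inner ℝ (b i) (V x)
      - inner ℝ (grad u x) (V x) *
        (inner ℝ (grad (laplacian (I := I) u) x) (b i) * inner ℝ (b i) (grad u x))
      - laplacian (I := I) u x * inner ℝ (grad u x) (V x) *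
        inner ℝ (leviCivita (grad u) x (b i)) (b i)
      - laplacian (I := I) u x *
        (inner ℝ (grad u x) (b i) * inner ℝ (b i) (nabla V (grad u) x)) := by
    intro i
    have hE := smoothAt_extend (I := I) (b i)
    rw [nablaTensor_chi hu hE hE hV, inner_nabla_grad_comm hu (extend E (b i)) V]
    simp only [← inner_grad, extend_apply_self, nabla, real_inner_comm (b i) (grad u x),
      real_inner_comm (b i) (leviCivita (grad u) x (V x))]
    ring
  -- This turns `Δu · Hess_u(V, grad u)` into the last term and accounts for its factor ½.
  have hNV : inner ℝ (grad N x) (V x) = 2 * (inner ℝ (grad u x) (nabla V (grad u) x) : ℝ) := by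
    rw [inner_grad, mvfderiv_inner hV hG hG, real_inner_comm]
    ring
  have hH := sum_nablaHess hu hV
  rw [← hb, ← inner_grad] at hH
  have hL := laplacian_eq_sum u b
  rw [divTensor]
  simp only [← hb, hterm, Finset.sum_add_distrib, Finset.sum_sub_distrib, ← Finset.mul_sum,
    b.sum_inner_mul_inner]
  rw [hH, ← hL, real_inner_comm (grad u x) (V x), real_inner_comm (grad N x) (V x), hNV,
    real_inner_comm (grad N x) (nabla V (grad u) x)]
  ring

end RiemGeom

end

theorem mainTheorem6 {m : ℕ} {M : Type*} [TopologicalSpace M]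
    [ChartedSpace (EuclideanSpace ℝ (Fin m)) M] [IsManifold (𝓡 m) ∞ M]
    [RiemannianBundle (fun x : M ↦ TangentSpace (𝓡 m) x)]
    [IsContMDiffRiemannianBundle (𝓡 m) ∞ (EuclideanSpace ℝ (Fin m))
      (fun x : M ↦ TangentSpace (𝓡 m) x)]
    (f : M → ℝ) (hf : ContMDiff (𝓡 m) 𝓘(ℝ) ∞ f)
    (V : Π x : M, TangentSpace (𝓡 m) x)
    (hV : ContMDiff (𝓡 m) (𝓡 m).tangent ∞ (fun x ↦ (⟨x, V x⟩ : TangentBundle (𝓡 m) M)))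
    (x : M) :
    divTensor (chi (I := 𝓡 m) f) V x =
      inner ℝ (nabla V (grad f) x) (grad (fun y ↦ ‖grad (I := 𝓡 m) f y‖ ^ 2) x)
      + ‖grad (I := 𝓡 m) f x‖ ^ 2 * ricci (grad f) V x
      + (1 + ‖grad (I := 𝓡 m) f x‖ ^ 2) * inner ℝ (grad (laplacian (I := 𝓡 m) f) x) (V x)
      - inner ℝ (grad (I := 𝓡 m) (laplacian (I := 𝓡 m) f) x) (grad f x)
          * inner ℝ (V x) (grad f x)
      - laplacian (I := 𝓡 m) f x ^ 2 * inner ℝ (V x) (grad f x)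
      - 1 / 2 * laplacian (I := 𝓡 m) f x
          * inner ℝ (V x) (grad (fun y ↦ ‖grad (I := 𝓡 m) f y‖ ^ 2) x) := by
  exact divTensor_chi hf (hV x)
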